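/- A filtration of a group $G$ is a sequence $(N_i)_{i\in\mathbb N}$ of normal subgroups of finite index in $G$ with $N_{i+1}\subseteq N_i$ for all $i$ and $\bigcap_i N_i=\{e\}$. We call it strict if $N_{i+1}\neq N_i$ whenever $N_i\neq\{e\}$; for infinite $G$ this means that the sequence is strictly decreasing. Given a finite generating set $S$ of $G$, the box space $\Box_{(N_i)}G$ is the disjoint union $\bigsqcup_i G/N_i$, where each $G/N_i$ carries the graph metric of its Cayley graph with respect to the image of $S$, and two points in distinct components $G/N_i$, $G/N_j$ are at distance $\operatorname{diam}(G/N_i)+\operatorname{diam}(G/N_j)$. (This may be only a pseudometric, because distinct one-point components are at distance $0$.) A map $\varphi\colon X\to Y$ between (pseudo)metric spaces is a coarse equivalence if there are functions $\rho_-,\rho_+\colon[0,\infty)\to[0,\infty)$, both tending to infinity at infinity, such that $\rho_-(d(a,b))\le d(\varphi(a),\varphi(b))\le\rho_+(d(a,b))$ for all $a,b\in X$, and a constant $C>0$ such that every $y\in Y$ is at distance at most $C$ from some point of $\varphi(X)$. If such a map exists, $X$ and $Y$ are called coarsely equivalent. An almost permutation of $\mathbb N$ is a bijection $f$ between two cofinite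 subsets of $\mathbb N$. It has bounded displacement if there are $A$ and $n_0$ such that $|f(n)-n|\le A$ for all $n\ge n_0$ in the domain of $f$. **Theorem.** Let $G$ be a finitely presented group and $H$ a finitely generated group, with filtrations $(N_i)$ and $(M_i)$ respectively, and with arbitrary finite generating sets used to define the box spaces. Suppose that $\Box_{(N_i)}G$ and $\Box_{(M_i)}H$ are coarsely equivalent. Then there is an almost permutation $f$ of $\mathbb N$ such that $N_i$ is isomorphic to $M_{f(i)}$ for every $i$ in the domain of $f$. If moreover both filtrations are strict, then $f$ can be chosen to have bounded displacement in addition. -/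

import Mathlib

open scoped NNReal

/-- A filtration of a group: a nested (decreasing) sequence of normal subgroups of finite index
with trivial intersection. Repetitions in the sequence are allowed here. -/
structure GroupFiltration (G : Type*) [Group G] where
  /-- the subgroups of the sequence -/
  sub : ℕ → Subgroup G
  normal : ∀ i, (sub i).Normal
  finiteIndex : ∀ i, (sub i).FiniteIndex
  antitone : Antitone sub
  iInf_eq_bot : ⨅ i, sub i = ⊥

namespace GroupFiltration

variable {G : Type*} [Group G]

instance (N : GroupFiltration G) (i : ℕ) : (N.sub i).Normal := N.normal i

instance (N : GroupFiltration G) (i : ℕ) : (N.sub i).FiniteIndex := N.finiteIndex i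

/-- The filtration has no repetition, except that the trivial subgroup may be repeated (as it must
be when the group is finite). For an infinite group this says that the sequence is strictly
decreasing. -/
def IsStrict (N : GroupFiltration G) : Prop :=
  ∀ i, N.sub i ≠ ⊥ → N.sub (i + 1) < N.sub i

/-- The Cayley graph of the quotient `G / N_i` with respect to the image of `S`. -/
def quotientCayley (N : GroupFiltration G) (S : Set G) (i : ℕ) : SimpleGraph (G ⧸ N.sub i) :=
  SimpleGraph.mulCayley ((fun g : G => (g : G ⧸ N.sub i)) '' S)

theorem quotientCayley_connected (N : GroupFiltration G) {S : Set G}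
    (hS : Subgroup.closure S = ⊤) (i : ℕ) : (N.quotientCayley S i).Connected := by
  have step : ∀ (x : G ⧸ N.sub i) (s : G), s ∈ S →
      (N.quotientCayley S i).Reachable x (x * (s : G ⧸ N.sub i)) := by
    intro x s hs
    by_cases h : x = x * (s : G ⧸ N.sub i)
    · rw [← h]
    · refine SimpleGraph.Adj.reachable ?_
      rw [quotientCayley, SimpleGraph.mulCayley_adj']
      exact ⟨h, _, ⟨s, hs, rfl⟩, Or.inl rfl⟩
  have key : ∀ g : G, ∀ x : G ⧸ N.sub i,
      (N.quotientCayley S i).Reachable x (x * (g : G ⧸ N.sub i)) := by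
    intro g
    have hg : g ∈ Subgroup.closure S := by rw [hS]; trivial
    induction hg using Subgroup.closure_induction with
    | mem s hs => exact fun x => step x s hs
    | one => intro x; simp
    | mul a b _ _ ha hb =>
      intro x
      have h := (ha x).trans (hb _)
      rwa [mul_assoc, ← QuotientGroup.mk_mul] at h
    | inv a _ ha =>
      intro x
      have h := (ha (x * ((a⁻¹ : G) : G ⧸ N.sub i))).symm
      rwa [mul_assoc, ← QuotientGroup.mk_mul, inv_mul_cancel, QuotientGroup.mk_one, mul_one] at h
  refine (SimpleGraph.connected_iff _).2 ⟨fun x y => ?_, ⟨1⟩⟩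
  obtain ⟨g, hg⟩ := QuotientGroup.mk_surjective (x⁻¹ * y)
  have h := key g x
  rwa [hg, mul_inv_cancel_left] at h

theorem dist_le_diam (N : GroupFiltration G) {S : Set G}
    (hS : Subgroup.closure S = ⊤) (i : ℕ) (x y : G ⧸ N.sub i) :
    (N.quotientCayley S i).dist x y ≤ (N.quotientCayley S i).diam :=
  SimpleGraph.dist_le_diam
    (SimpleGraph.connected_iff_ediam_ne_top.1 (N.quotientCayley_connected hS i))

/-- The box space of `G` with respect to the filtration `N` and the generating set `S`: as a set,
the disjoint union of the quotients `G / N_i`. -/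
def BoxSpace (N : GroupFiltration G) (S : Set G) (_hS : Subgroup.closure S = ⊤) : Type _ :=
  Σ i : ℕ, G ⧸ N.sub i

open Classical in
/-- The distance on the box space: the graph metric of the Cayley graph inside each component,
and the sum of the diameters between points of two distinct components. -/
noncomputable def boxDist (N : GroupFiltration G) (S : Set G) (p q : Σ i : ℕ, G ⧸ N.sub i) : ℝ :=
  if h : p.1 = q.1 then ((N.quotientCayley S q.1).dist (h ▸ p.2) q.2 : ℝ)
  else ((N.quotientCayley S p.1).diam : ℝ) + ((N.quotientCayley S q.1).diam : ℝ)

theorem boxDist_same (N : GroupFiltration G) (S : Set G) (i : ℕ) (x y : G ⧸ N.sub i) :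
    N.boxDist S ⟨i, x⟩ ⟨i, y⟩ = ((N.quotientCayley S i).dist x y : ℝ) := by
  simp [boxDist]

theorem boxDist_ne (N : GroupFiltration G) (S : Set G) {i j : ℕ} (h : i ≠ j)
    (x : G ⧸ N.sub i) (y : G ⧸ N.sub j) :
    N.boxDist S ⟨i, x⟩ ⟨j, y⟩ =
      ((N.quotientCayley S i).diam : ℝ) + ((N.quotientCayley S j).diam : ℝ) := by
  simp [boxDist, h]

/-- This is only a pseudometric in general, since distinct one-point components are at
distance `0`. -/
noncomputable instance (N : GroupFiltration G) (S : Set G) (hS : Subgroup.closure S = ⊤) :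
    PseudoMetricSpace (N.BoxSpace S hS) where
  dist := N.boxDist S
  dist_self := by
    rintro ⟨i, x⟩
    simp [boxDist_same]
  dist_comm := by
    rintro ⟨i, x⟩ ⟨j, y⟩
    by_cases h : i = j
    · subst h
      rw [boxDist_same, boxDist_same, SimpleGraph.dist_comm]
    · rw [boxDist_ne _ _ h, boxDist_ne _ _ (Ne.symm h), add_comm]
  dist_triangle := by
    rintro ⟨i, x⟩ ⟨j, y⟩ ⟨k, z⟩
    have hd : ∀ (l : ℕ) (a b : G ⧸ N.sub l), ((N.quotientCayley S l).dist a b : ℝ) ≤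
        ((N.quotientCayley S l).diam : ℝ) := fun l a b => by
      exact_mod_cast N.dist_le_diam hS l a b
    have h0 : ∀ l : ℕ, (0 : ℝ) ≤ ((N.quotientCayley S l).diam : ℝ) := fun l => by positivity
    by_cases hij : i = j
    · subst hij
      by_cases hik : i = k
      · subst hik
        simp only [boxDist_same]
        exact_mod_cast (N.quotientCayley_connected hS i).dist_triangle
      · rw [boxDist_same, boxDist_ne _ _ hik, boxDist_ne _ _ hik]
        have : (0 : ℝ) ≤ ((N.quotientCayley S i).dist x y : ℝ) := by positivity
        linarith
    · by_cases hik : i = k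
      · subst hik
        rw [boxDist_same, boxDist_ne _ _ hij, boxDist_ne _ _ (Ne.symm hij)]
        linarith [hd i x z, h0 i, h0 j]
      · rw [boxDist_ne _ _ hij, boxDist_ne _ _ hik]
        by_cases hjk : j = k
        · subst hjk
          rw [boxDist_same]
          have : (0 : ℝ) ≤ ((N.quotientCayley S j).dist y z : ℝ) := by positivity
          linarith
        · rw [boxDist_ne _ _ hjk]
          linarith [h0 j]

end GroupFiltration

/-- A map is a coarse embedding if its distortion is controlled from both sides by proper functions
`ℝ₊ → ℝ₊` (preimages of bounded sets are bounded, that is, the functions tend to infinity at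
infinity). -/
def IsCoarseEmbedding {X Y : Type*} [PseudoMetricSpace X] [PseudoMetricSpace Y]
    (φ : X → Y) : Prop :=
  ∃ ρ₁ ρ₂ : ℝ≥0 → ℝ≥0, Filter.Tendsto ρ₁ Filter.atTop Filter.atTop ∧
    Filter.Tendsto ρ₂ Filter.atTop Filter.atTop ∧
    ∀ a b : X, ρ₁ (nndist a b) ≤ nndist (φ a) (φ b) ∧ nndist (φ a) (φ b) ≤ ρ₂ (nndist a b)

/-- A coarse equivalence is a coarse embedding whose image is coarsely dense. -/
def IsCoarseEquivalence {X Y : Type*} [PseudoMetricSpace X] [PseudoMetricSpace Y]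
    (φ : X → Y) : Prop :=
  IsCoarseEmbedding φ ∧ ∃ C : ℝ, 0 < C ∧ ∀ y : Y, ∃ x : X, dist (φ x) y ≤ C

/-- Two spaces are coarsely equivalent if there is a coarse equivalence between them. -/
def CoarselyEquivalent (X Y : Type*) [PseudoMetricSpace X] [PseudoMetricSpace Y] : Prop :=
  ∃ φ : X → Y, IsCoarseEquivalence φ

/-- An almost permutation of `ℕ` is a bijection between two cofinite subsets of `ℕ`
(its domain `f.source` and its range `f.target`). -/
def IsAlmostPermutation (f : PartialEquiv ℕ ℕ) : Prop :=
  f.sourceᶜ.Finite ∧ f.targetᶜ.Finite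

/-- `f` has bounded displacement if `|f n - n|` is bounded for all large `n` in its domain. -/
def HasBoundedDisplacement (f : PartialEquiv ℕ ℕ) : Prop :=
  ∃ A n₀ : ℕ, ∀ n ∈ f.source, n₀ ≤ n → |(f n : ℤ) - (n : ℤ)| ≤ (A : ℤ)

/-! ### Balls in marked groups -/

section WordBall

variable {α G H : Type*} [Group G] [Group H]

/-! If `G` is finite, its box space is bounded, so `H` is finite as well; both filtrations are
eventually trivial and the identity, restricted to a cofinite set, works. Let both groups be
infinite. The diameters of the components tend to infinity, so the coarse equivalence eventually
maps components into components. The induced index maps of the equivalence and of its coarse inverse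
are eventually inverse to each other, which gives the almost permutation, and the maps `G / N_i → H
/ M_{f(i)}` are coarse equivalences with a common constant `L`.

Such a map lifts to the groups: relators of `G` have bounded length, their images are short loops,
and short loops in `H / M_j` lift to loops in `H` for large `j` (`exists_lift`). Lifts are unique
(`lift_unique`), so the lift is multiplicative on `N_i`, and the lift of the coarse inverse undoes
it there; hence `N_i ≃ M_{f(i)}` (`exists_ker_mulEquiv`).

Lifting back needs a finite presentation of `H`. One first replaces `H` by the group `Q` presented
by the relators of `H` of a fixed bounded length. The isomorphism between the kernels in `Q` and in
`G` expands word length by at most the factor `L`, whereas the kernels in `G` avoid any given ball.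
So a word trivial in `H` is trivial in `Q`, and `Q = H` (`eventually_nonempty_ker_mulEquiv`).

For the displacement, `|G / N_i|` and `|H / M_{f(i)}|` agree up to a constant factor, while the
orders at least double at each step of a strict filtration. Hence `f` preserves the order of indices
that are far apart, and counting bounds `f n - n`. -/

/-- The elements represented by words of length at most `n` in the images of the generators. -/
def wordBall (π : FreeGroup α →* G) (n : ℕ) : Set G :=
  {g | ∃ l : List (α × Bool), l.length ≤ n ∧ π (FreeGroup.mk l) = g}

namespace wordBall

variable {π : FreeGroup α →* G} {m n : ℕ} {g h : G}

theorem mk_mem (π : FreeGroup α →* G) (l : List (α × Bool)) :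
    π (FreeGroup.mk l) ∈ wordBall π l.length := ⟨l, le_rfl, rfl⟩

theorem mono (hmn : m ≤ n) (hg : g ∈ wordBall π m) : g ∈ wordBall π n := by
  obtain ⟨l, hl, rfl⟩ := hg
  exact ⟨l, hl.trans hmn, rfl⟩

theorem one_mem : (1 : G) ∈ wordBall π n :=
  ⟨[], by simp, by rw [← FreeGroup.one_eq_mk, map_one]⟩

theorem of_mem (a : α) : π (FreeGroup.of a) ∈ wordBall π 1 := ⟨[(a, true)], by simp, rfl⟩

theorem mul_mem (hg : g ∈ wordBall π m) (hh : h ∈ wordBall π n) : g * h ∈ wordBall π (m + n) := by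
  obtain ⟨l, hl, rfl⟩ := hg
  obtain ⟨l', hl', rfl⟩ := hh
  exact ⟨l ++ l', by simp; omega, by rw [← FreeGroup.mul_mk, map_mul]⟩

theorem inv_mem (hg : g ∈ wordBall π m) : g⁻¹ ∈ wordBall π m := by
  obtain ⟨l, hl, rfl⟩ := hg
  exact ⟨FreeGroup.invRev l, by simpa using hl, by rw [← FreeGroup.inv_mk, map_inv]⟩

theorem map_mem (f : G →* H) (hg : g ∈ wordBall π m) : f g ∈ wordBall (f.comp π) m := by
  obtain ⟨l, hl, rfl⟩ := hg
  exact ⟨l, hl, rfl⟩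

theorem exists_of_comp {f : G →* H} {y : H} (hy : y ∈ wordBall (f.comp π) m) :
    ∃ g ∈ wordBall π m, f g = y := by
  obtain ⟨l, hl, rfl⟩ := hy
  exact ⟨_, ⟨l, hl, rfl⟩, rfl⟩

theorem finite [Finite α] (π : FreeGroup α →* G) (n : ℕ) : (wordBall π n).Finite := by
  refine ((List.finite_length_le (α × Bool) n).image fun l => π (FreeGroup.mk l)).subset ?_
  rintro _ ⟨l, hl, rfl⟩
  exact ⟨l, hl, rfl⟩

theorem ncard_comp_le [Finite α] (π : FreeGroup α →* G) (f : G →* H) (n : ℕ) :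
    (wordBall (f.comp π) n).ncard ≤ (wordBall π n).ncard := by
  refine (Set.ncard_le_ncard (t := f '' wordBall π n) (fun y hy => ?_)
    ((wordBall.finite π n).image f)).trans (Set.ncard_image_le (wordBall.finite π n))
  exact exists_of_comp hy

theorem exists_mem (hπ : Function.Surjective π) (g : G) : ∃ n, g ∈ wordBall π n := by
  obtain ⟨w, rfl⟩ := hπ g
  obtain ⟨l, rfl⟩ := Quot.exists_rep w
  exact ⟨_, mk_mem π l⟩

theorem exists_subset (hπ : Function.Surjective π) {F : Set G} (hF : F.Finite) :
    ∃ n, F ⊆ wordBall π n := by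
  choose r hr using exists_mem hπ
  obtain ⟨n, hn⟩ := (hF.image r).bddAbove
  exact ⟨n, fun g hg => mono (hn ⟨g, hg, rfl⟩) (hr g)⟩

end wordBall

end WordBall

/-! ### Normalised coarse equivalences of marked groups -/

/-- A pair of mutually inverse (up to bounded error) coarse maps between two marked groups,
normalised at the identity, with all errors controlled by words of length at most `L`. -/
structure MarkedCoarseEquiv {α β X Y : Type*} [Group X] [Group Y]
    (πX : FreeGroup α →* X) (πY : FreeGroup β →* Y) (L : ℕ) where
  toFun : X → Y
  invFun : Y → X
  toFun_one : toFun 1 = 1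
  invFun_one : invFun 1 = 1
  toFun_step : ∀ x a, ∃ y ∈ wordBall πY L, toFun (x * πX (FreeGroup.of a)) = toFun x * y
  invFun_step : ∀ y b, ∃ x ∈ wordBall πX L, invFun (y * πY (FreeGroup.of b)) = invFun y * x
  invFun_toFun : ∀ x, ∃ g ∈ wordBall πX L, invFun (toFun x) = x * g
  toFun_invFun : ∀ y, ∃ h ∈ wordBall πY L, toFun (invFun y) = y * h

namespace MarkedCoarseEquiv

variable {α β X Y : Type*} [Group X] [Group Y]
  {πX : FreeGroup α →* X} {πY : FreeGroup β →* Y} {L : ℕ}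

/-- The same pair with the roles of the two groups exchanged. -/
def symm (c : MarkedCoarseEquiv πX πY L) : MarkedCoarseEquiv πY πX L :=
  ⟨c.invFun, c.toFun, c.invFun_one, c.toFun_one, c.invFun_step, c.toFun_step, c.toFun_invFun,
    c.invFun_toFun⟩

/-- A point `x` is recovered from `toFun x` and the error `g` in `invFun (toFun x) = x * g`, and `g`
ranges over one ball. -/
theorem card_le [Finite α] [Finite Y] (c : MarkedCoarseEquiv πX πY L) :
    Nat.card X ≤ Nat.card Y * (wordBall πX L).ncard := by
  choose g hg h using c.invFun_toFun
  have hfin : Finite (wordBall πX L) := wordBall.finite πX L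
  have : Function.Injective fun x : X => ((c.toFun x, ⟨g x, hg x⟩) : Y × wordBall πX L) := by
    intro x x' hx
    simp only [Prod.mk.injEq, Subtype.mk.injEq] at hx
    have h1 := h x
    rw [hx.1, hx.2, h x'] at h1
    exact (mul_right_cancel h1).symm
  have := Nat.card_le_card_of_injective _ this
  rwa [Nat.card_prod, Nat.card_coe_set_eq] at this

end MarkedCoarseEquiv

/-! ### Lifting coarse maps from quotients to groups -/

section Lift

variable {α β G Q X Y : Type*} [Group G] [Group Q] [Group X] [Group Y]

/-- A map between quotients of a finitely presented group `G` and of a group `Q` lifts to a map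
`G → Q`, provided the loops coming from relators of `G` lift to loops in `Q`. -/
theorem exists_lift {π : FreeGroup α →* G} (hπ : Function.Surjective π)
    {R : Set (FreeGroup α)} (hker : π.ker = Subgroup.normalClosure R) {ρ : ℕ}
    (hR : ∀ r ∈ R, ∃ l, l.length ≤ ρ ∧ FreeGroup.mk l = r) (p : G →* X)
    {π' : FreeGroup β →* Q} (q : Q →* Y) {φ : X → Y} {L : ℕ} (h1 : φ 1 = 1)
    (hstep : ∀ x a, ∃ y ∈ wordBall (q.comp π') L,
      φ (x * p.comp π (FreeGroup.of a)) = φ x * y)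
    (hinj : ∀ h ∈ wordBall π' (L * ρ), q h = 1 → h = 1) :
    ∃ u : G → Q, u 1 = 1 ∧ (∀ g, q (u g) = φ (p g)) ∧
      ∀ g l, ∃ h ∈ wordBall π' (L * l.length), u (g * π (FreeGroup.mk l)) = u g * h := by
  have hstep' : ∀ x a, ∃ h ∈ wordBall π' L, φ (x * p (π (FreeGroup.of a))) = φ x * q h := by
    intro x a
    obtain ⟨y, hy, e⟩ := hstep x a
    obtain ⟨h, hh, rfl⟩ := wordBall.exists_of_comp hy
    exact ⟨h, hh, e⟩
  choose b hb hφ using hstep'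
  -- On the fibre product of `φ` and `q` each generator acts by a permutation: it moves `x` to `x *
  -- a` and the second coordinate by the displacement chosen at `x`. The inverse therefore uses the
  -- displacement at the preceding point.
  let Z := {z : X × Q // φ z.1 = q z.2}
  let e : α → Equiv.Perm Z := fun a =>
    { toFun := fun z => ⟨(z.1.1 * p (π (FreeGroup.of a)), z.1.2 * b z.1.1 a), by
        simp only [hφ, z.2, map_mul]⟩
      invFun := fun z => ⟨(z.1.1 * (p (π (FreeGroup.of a)))⁻¹,
          z.1.2 * (b (z.1.1 * (p (π (FreeGroup.of a)))⁻¹) a)⁻¹), by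
        have := hφ (z.1.1 * (p (π (FreeGroup.of a)))⁻¹) a
        rw [inv_mul_cancel_right, z.2] at this
        simp [this]⟩
      left_inv := fun z => by
        apply Subtype.ext
        simp
      right_inv := fun z => by
        apply Subtype.ext
        simp }
  -- Words act from the right, hence the opposite group.
  let Θ : FreeGroup α →* (Equiv.Perm Z)ᵐᵒᵖ := FreeGroup.lift fun a => MulOpposite.op (e a)
  have hΘof : ∀ a, Θ (FreeGroup.of a) = MulOpposite.op (e a) := fun a => by simp [Θ]
  have key : ∀ (l : List (α × Bool)) (z : Z),
      ((Θ (FreeGroup.mk l)).unop z).1.1 = z.1.1 * p (π (FreeGroup.mk l)) ∧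
      ∃ h ∈ wordBall π' (L * l.length), ((Θ (FreeGroup.mk l)).unop z).1.2 = z.1.2 * h := by
    intro l
    induction l with
    | nil =>
      intro z
      rw [← FreeGroup.one_eq_mk]
      exact ⟨by simp, 1, wordBall.one_mem, by simp⟩
    | cons s l ih =>
      intro z
      have hs : ∃ z' : Z, (Θ (FreeGroup.mk [s])).unop z = z' ∧
          z'.1.1 = z.1.1 * p (π (FreeGroup.mk [s])) ∧
          ∃ h ∈ wordBall π' L, z'.1.2 = z.1.2 * h := by
        refine ⟨_, rfl, ?_⟩
        obtain ⟨a, _ | _⟩ := s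
        · have : FreeGroup.mk [(a, false)] = (FreeGroup.of a)⁻¹ := rfl
          rw [this, map_inv, hΘof, ← MulOpposite.op_inv, MulOpposite.unop_op, map_inv, map_inv]
          exact ⟨rfl, _, wordBall.inv_mem (hb _ _), rfl⟩
        · have : FreeGroup.mk [(a, true)] = FreeGroup.of a := rfl
          rw [this, hΘof, MulOpposite.unop_op]
          exact ⟨rfl, _, hb _ _, rfl⟩
      obtain ⟨z', hz', hz1, h, hh, hz2⟩ := hs
      have hcons : FreeGroup.mk (s :: l) = FreeGroup.mk [s] * FreeGroup.mk l := by
        rw [FreeGroup.mul_mk]; rfl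
      rw [hcons, map_mul, MulOpposite.unop_mul, Equiv.Perm.mul_apply, hz']
      obtain ⟨ih1, h', hh', ih2⟩ := ih z'
      refine ⟨by rw [ih1, hz1, map_mul, map_mul, mul_assoc], h * h', ?_, ?_⟩
      · refine wordBall.mono (le_of_eq ?_) (wordBall.mul_mem hh hh')
        simp; ring
      · rw [ih2, hz2, mul_assoc]
  -- A relator fixes the first coordinate, so it moves the second by an element of `q.ker` of length
  -- at most `L * ρ`, which is trivial by `hinj`. The action thus descends to `G`, and `u` is the
  -- second coordinate along the orbit of `(1, 1)`.
  have hRΘ : π.ker ≤ Θ.ker := by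
    rw [hker]
    refine Subgroup.normalClosure_le_normal fun r hr => ?_
    have hr1 : π r = 1 := by
      have : r ∈ π.ker := hker ▸ Subgroup.subset_normalClosure hr
      exact this
    obtain ⟨l, hl, rfl⟩ := hR r hr
    rw [SetLike.mem_coe, MonoidHom.mem_ker, ← MulOpposite.unop_inj, MulOpposite.unop_one]
    ext z : 1
    obtain ⟨k1, h, hh, k2⟩ := key l z
    rw [hr1, map_one, mul_one] at k1
    have hq : q h = 1 := by
      have := ((Θ (FreeGroup.mk l)).unop z).2
      rw [k1, k2, z.2, map_mul] at this
      simpa using this.symm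
    have hh1 := hinj h (wordBall.mono (Nat.mul_le_mul_left _ hl) hh) hq
    rw [hh1, mul_one] at k2
    exact Subtype.ext (Prod.ext k1 k2)
  have hΘeq : ∀ w w', π w = π w' → Θ w = Θ w' := by
    intro w w' hw
    have : w⁻¹ * w' ∈ π.ker := by rw [MonoidHom.mem_ker, map_mul, map_inv, hw, inv_mul_cancel]
    have := hRΘ this
    rw [MonoidHom.mem_ker, map_mul, map_inv] at this
    exact inv_mul_eq_one.1 this
  let z₀ : Z := ⟨(1, 1), by simp [h1]⟩
  let v : G → FreeGroup α := Function.surjInv hπ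
  have hv : ∀ g, π (v g) = g := Function.surjInv_eq hπ
  have hfst : ∀ w, ((Θ w).unop z₀).1.1 = p (π w) := by
    intro w
    obtain ⟨l, rfl⟩ := Quot.exists_rep w
    exact (key l z₀).1.trans (one_mul _)
  refine ⟨fun g => ((Θ (v g)).unop z₀).1.2, ?_, fun g => ?_, fun g l => ?_⟩
  · simp only
    rw [hΘeq (v 1) 1 (by rw [hv, map_one]), map_one]
    rfl
  · have := ((Θ (v g)).unop z₀).2
    rw [← this, hfst, hv]
  · simp only
    rw [hΘeq (v (g * π (FreeGroup.mk l))) (v g * FreeGroup.mk l) (by simp [hv]), map_mul,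
      MulOpposite.unop_mul, Equiv.Perm.mul_apply]
    exact (key l _).2

/-- Two lifts of the same map which agree at the identity are equal. -/
theorem lift_unique {π : FreeGroup α →* G} (hπ : Function.Surjective π)
    {π' : FreeGroup β →* Q} (q : Q →* Y) {m n : ℕ}
    (hinj : ∀ h ∈ wordBall π' (m + n), q h = 1 → h = 1) {u v : G → Q}
    (huv : ∀ g, q (u g) = q (v g)) (h1 : u 1 = v 1)
    (hu : ∀ g a, ∃ h ∈ wordBall π' m, u (g * π (FreeGroup.of a)) = u g * h)
    (hv : ∀ g a, ∃ h ∈ wordBall π' n, v (g * π (FreeGroup.of a)) = v g * h) : u = v := by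
  -- An equivalence rather than an implication, so that inverse letters are covered. Where `u` and
  -- `v` agree, their next displacements have the same image under `q` and are short, hence equal.
  have key : ∀ w g, u g = v g ↔ u (g * π w) = v (g * π w) := by
    intro w
    induction w using FreeGroup.induction_on with
    | C1 => intro g; simp
    | of a =>
      intro g
      obtain ⟨h, hh, e⟩ := hu g a
      obtain ⟨h', hh', e'⟩ := hv g a
      have hqg := huv g
      have hqa := huv (g * π (FreeGroup.of a))
      rw [e, e', map_mul, map_mul, hqg, mul_left_cancel_iff] at hqa
      have : h⁻¹ * h' = 1 := hinj _ (wordBall.mul_mem (wordBall.inv_mem hh) hh') (by simp [hqa])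
      rw [e, e', inv_mul_eq_one.1 this, mul_left_inj]
    | inv_of a ih =>
      intro g
      have := ih (g * π (FreeGroup.of a)⁻¹)
      rw [mul_assoc, ← map_mul, inv_mul_cancel, map_one, mul_one] at this
      exact this.symm
    | mul x y hx hy =>
      intro g
      rw [hx g, hy (g * π x), map_mul, mul_assoc]
  funext g
  obtain ⟨w, rfl⟩ := hπ g
  simpa using (key w 1).1 h1

/-- Translation by `n` does not change `p`, so `u` and `g ↦ (u n)⁻¹ * u (n * g)` lift the same map
and agree at `1`. -/
theorem lift_mul_of_mem_ker {π : FreeGroup α →* G} (hπ : Function.Surjective π) (p : G →* X)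
    {π' : FreeGroup β →* Q} (q : Q →* Y) {φ : X → Y} {L : ℕ} (h1 : φ 1 = 1)
    (hinj : ∀ h ∈ wordBall π' (L + L), q h = 1 → h = 1) {u : G → Q} (hu1 : u 1 = 1)
    (huq : ∀ g, q (u g) = φ (p g))
    (hu : ∀ g a, ∃ h ∈ wordBall π' L, u (g * π (FreeGroup.of a)) = u g * h)
    {n : G} (hn : p n = 1) (g : G) : u (n * g) = u n * u g := by
  have hqn : q (u n) = 1 := by rw [huq, hn, h1]
  have : u = fun g => (u n)⁻¹ * u (n * g) := by
    refine lift_unique hπ q hinj (fun g => ?_) (by simp [hu1]) hu fun g a => ?_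
    · simp [huq, hn, h1]
    · obtain ⟨h, hh, e⟩ := hu (n * g) a
      exact ⟨h, hh, by rw [← mul_assoc, e, mul_assoc]⟩
  rw [congrFun this g, mul_inv_cancel_left]

/-- The error of `c.invFun ∘ c.toFun` lifts to a short `d (p g)`. Both `v ∘ u` and `g ↦ g * d (p g)`
lift `c.invFun ∘ c.toFun ∘ p`, so they coincide; on `p.ker` the correction is `d 1 = 1`. -/
theorem lift_comp_lift_of_mem_ker {π : FreeGroup α →* G} (hπ : Function.Surjective π) (p : G →* X)
    {π' : FreeGroup β →* Q} (q : Q →* Y) {L : ℕ}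
    (c : MarkedCoarseEquiv (p.comp π) (q.comp π') L)
    (hinj : ∀ g ∈ wordBall π ((L + 1) ^ 2), p g = 1 → g = 1)
    {u : G → Q} (hu1 : u 1 = 1) (huq : ∀ g, q (u g) = c.toFun (p g))
    (hu : ∀ g a, ∃ h ∈ wordBall π' L, u (g * π (FreeGroup.of a)) = u g * h)
    {v : Q → G} (hv1 : v 1 = 1) (hvp : ∀ h, p (v h) = c.invFun (q h))
    (hv : ∀ h l, ∃ g ∈ wordBall π (L * l.length), v (h * π' (FreeGroup.mk l)) = v h * g)
    {n : G} (hn : p n = 1) : v (u n) = n := by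
  have : ∀ x, ∃ g ∈ wordBall π L, c.invFun (c.toFun x) = x * p g := by
    intro x
    obtain ⟨y, hy, e⟩ := c.invFun_toFun x
    obtain ⟨g, hg, rfl⟩ := wordBall.exists_of_comp hy
    exact ⟨g, hg, e⟩
  choose d hd hcd using this
  have hd1 : d 1 = 1 := by
    refine hinj _ (wordBall.mono (by nlinarith) (hd 1)) ?_
    have := hcd 1
    rwa [c.toFun_one, c.invFun_one, one_mul, eq_comm] at this
  have huv : (fun g => v (u g)) = fun g => g * d (p g) := by
    -- One generator moves `v ∘ u` by at most `L * L` and the other lift by `d⁻¹ * a * d'`, of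
    -- length at most `L + 1 + L`; the sum is `(L + 1) ^ 2`.
    refine lift_unique (π' := π) (m := L * L) (n := L + 1 + L) hπ p ?_ ?_ ?_ ?_ ?_
    · convert hinj using 4
      ring
    · intro g
      rw [hvp, huq, hcd, map_mul]
    · simp [hu1, hv1, hd1]
    · intro g a
      obtain ⟨_, ⟨l, hl, rfl⟩, e⟩ := hu g a
      obtain ⟨k, hk, e'⟩ := hv (u g) l
      exact ⟨k, wordBall.mono (Nat.mul_le_mul_left _ hl) hk, by simp only [e, e']⟩
    · intro g a
      exact ⟨_, wordBall.mul_mem (wordBall.mul_mem (wordBall.inv_mem (hd (p g)))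
        (wordBall.of_mem a)) (hd (p (g * π (FreeGroup.of a)))), by group⟩
  have := congrFun huv n
  simpa [hn, hd1] using this

/-- A coarse equivalence between quotients of two finitely presented groups by subgroups with
large injectivity radius induces an isomorphism between these subgroups. -/
theorem exists_ker_mulEquiv {π : FreeGroup α →* G} (hπ : Function.Surjective π)
    {R : Set (FreeGroup α)} (hker : π.ker = Subgroup.normalClosure R) {ρ : ℕ}
    (hR : ∀ r ∈ R, ∃ l, l.length ≤ ρ ∧ FreeGroup.mk l = r) (p : G →* X)
    {π' : FreeGroup β →* Q} (hπ' : Function.Surjective π')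
    {R' : Set (FreeGroup β)} (hker' : π'.ker = Subgroup.normalClosure R') {ρ' : ℕ}
    (hR' : ∀ r ∈ R', ∃ l, l.length ≤ ρ' ∧ FreeGroup.mk l = r) (q : Q →* Y) {L : ℕ}
    (c : MarkedCoarseEquiv (p.comp π) (q.comp π') L)
    (hinj : ∀ g ∈ wordBall π (L * ρ' + (L + 1) ^ 2), p g = 1 → g = 1)
    (hinj' : ∀ h ∈ wordBall π' (L * ρ + (L + 1) ^ 2), q h = 1 → h = 1) :
    ∃ e : q.ker ≃* p.ker, ∀ (l : List (β × Bool)) (h : q.ker), π' (FreeGroup.mk l) = h →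
      (e h : G) ∈ wordBall π (L * l.length) := by
  obtain ⟨u, hu1, huq, hu⟩ := exists_lift hπ hker hR p q c.toFun_one c.toFun_step
    fun h hh => hinj' h (wordBall.mono (by omega) hh)
  obtain ⟨v, hv1, hvp, hv⟩ := exists_lift hπ' hker' hR' q p c.invFun_one c.invFun_step
    fun h hh => hinj h (wordBall.mono (by omega) hh)
  have hu' : ∀ g a, ∃ h ∈ wordBall π' L, u (g * π (FreeGroup.of a)) = u g * h := fun g a => by
    simpa [FreeGroup.of] using hu g [(a, true)]
  have hv' : ∀ h b, ∃ g ∈ wordBall π L, v (h * π' (FreeGroup.of b)) = v h * g := fun g a => by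
    simpa [FreeGroup.of] using hv g [(a, true)]
  refine ⟨{ toFun := fun h => ⟨v h, by rw [MonoidHom.mem_ker, hvp, h.2, c.invFun_one]⟩
            invFun := fun g => ⟨u g, by rw [MonoidHom.mem_ker, huq, g.2, c.toFun_one]⟩
            left_inv := fun h => Subtype.ext ?_
            right_inv := fun g => Subtype.ext ?_
            map_mul' := fun h h' => Subtype.ext ?_ }, fun l h hl => ?_⟩
  · exact lift_comp_lift_of_mem_ker hπ' q p c.symm
      (fun h hh => hinj' h (wordBall.mono (by omega) hh)) hv1 hvp hv' hu1 huq hu h.2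
  · exact lift_comp_lift_of_mem_ker hπ p q c
      (fun h hh => hinj h (wordBall.mono (by omega) hh)) hu1 huq hu' hv1 hvp hv g.2
  · exact lift_mul_of_mem_ker hπ' q p c.invFun_one
      (fun h hh => hinj h (wordBall.mono (by nlinarith) hh)) hv1 hvp hv' h.2 h'
  · obtain ⟨g, hg, e⟩ := hv 1 l
    rw [one_mul, hl, hv1, one_mul] at e
    simpa [e] using hg

end Lift

/-! ### Kernels in families, and finite presentation of the second group -/

section KernelFamily

open Filter

theorem eventually_forall_mem_ker_eq_one {ι G : Type*} [Group G] {l : Filter ι} {X : ι → Type*}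
    [∀ i, Group (X i)] {p : ∀ i, G →* X i} (hp : ∀ g, g ≠ 1 → ∀ᶠ i in l, p i g ≠ 1)
    {F : Set G} (hF : F.Finite) : ∀ᶠ i in l, ∀ g ∈ F, p i g = 1 → g = 1 := by
  refine (eventually_all_finite hF).2 fun g _ => ?_
  by_cases hg : g = 1
  · exact Eventually.of_forall fun _ _ => hg
  · filter_upwards [hp g hg] with i hi h using absurd h hi

/-- Uniform coarse equivalences between the quotients of a finitely presented group and of a
finitely generated group, along families of normal subgroups that eventually avoid each nontrivial
element, force the corresponding normal subgroups to be eventually isomorphic. -/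
theorem eventually_nonempty_ker_mulEquiv {ι α β G H : Type*} [Group G] [Group H] [Finite α]
    [Finite β] {l : Filter ι} [l.NeBot] {π : FreeGroup α →* G} (hπ : Function.Surjective π)
    (hker : π.ker.IsFinitelyNormallyGenerated)
    {π' : FreeGroup β →* H} (hπ' : Function.Surjective π')
    {X Y : ι → Type*} [∀ i, Group (X i)] [∀ i, Group (Y i)] {p : ∀ i, G →* X i}
    {q : ∀ i, H →* Y i} (hp : ∀ g, g ≠ 1 → ∀ᶠ i in l, p i g ≠ 1)
    (hq : ∀ h, h ≠ 1 → ∀ᶠ i in l, q i h ≠ 1) {L : ℕ}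
    (hc : ∀ᶠ i in l, Nonempty (MarkedCoarseEquiv ((p i).comp π) ((q i).comp π') L)) :
    ∀ᶠ i in l, Nonempty ((p i).ker ≃* (q i).ker) := by
  obtain ⟨R, hRfin, hRker⟩ := hker
  obtain ⟨ρ, hρ⟩ := wordBall.exists_subset (π := MonoidHom.id (FreeGroup α))
    Function.surjective_id hRfin
  have hR : ∀ r ∈ R, ∃ l, l.length ≤ ρ ∧ FreeGroup.mk l = r := fun r hr => hρ hr
  set ρ' := L * ρ + (L + 1) ^ 2 with hρ'
  let R' : Set (FreeGroup β) := {r | (∃ l, l.length ≤ ρ' ∧ FreeGroup.mk l = r) ∧ π' r = 1}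
  have hR' : ∀ r ∈ R', ∃ l, l.length ≤ ρ' ∧ FreeGroup.mk l = r := fun r hr => hr.1
  have hle : Subgroup.normalClosure R' ≤ π'.ker :=
    Subgroup.normalClosure_le_normal fun r hr => hr.2
  have hinjp : ∀ n, ∀ᶠ i in l, ∀ g ∈ wordBall π n, p i g = 1 → g = 1 := fun n =>
    eventually_forall_mem_ker_eq_one hp (wordBall.finite π n)
  have hinjq : ∀ n, ∀ᶠ i in l, ∀ h ∈ wordBall π' n, q i h = 1 → h = 1 := fun n =>
    eventually_forall_mem_ker_eq_one hq (wordBall.finite π' n)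
  have hker' : π'.ker = Subgroup.normalClosure R' := by
    refine le_antisymm (fun w hw => ?_) hle
    let Q := FreeGroup β ⧸ Subgroup.normalClosure R'
    let σ : FreeGroup β →* Q := QuotientGroup.mk' _
    let τ : Q →* H := QuotientGroup.lift _ π' hle
    have hτσ : τ.comp σ = π' := by ext; rfl
    have hσ : Function.Surjective σ := QuotientGroup.mk'_surjective _
    have hσker : σ.ker = Subgroup.normalClosure R' := QuotientGroup.ker_mk' _
    obtain ⟨lw, rfl⟩ := Quot.exists_rep w
    obtain ⟨i, hi, hi1, hi2, hi3⟩ := (hc.and ((hinjp (L * ρ' + (L + 1) ^ 2)).and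
      ((hinjq ρ').and (hinjp (L * lw.length))))).exists
    obtain ⟨c⟩ := hi
    have hcomp : (q i).comp π' = ((q i).comp τ).comp σ := by rw [MonoidHom.comp_assoc, hτσ]
    rw [hcomp] at c
    obtain ⟨e, he⟩ := exists_ker_mulEquiv hπ hRker.symm hR (p i) hσ hσker hR' ((q i).comp τ) c hi1
      -- A word of length at most `ρ'` that dies in `Y i` already dies in `H`, hence belongs to `R'`
      -- and dies in `Q`.
      (by
        rintro _ ⟨m, hm, rfl⟩ hqm
        have hm1 : π' (FreeGroup.mk m) = 1 := hi2 _ ⟨m, hm, rfl⟩ hqm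
        have : FreeGroup.mk m ∈ σ.ker := by
          rw [hσker]
          exact Subgroup.subset_normalClosure ⟨⟨m, hm, rfl⟩, hm1⟩
        exact this)
    have hw' : τ (σ (FreeGroup.mk lw)) = 1 := hw
    let k : ((q i).comp τ).ker := ⟨σ (FreeGroup.mk lw), by
      rw [MonoidHom.mem_ker, MonoidHom.comp_apply, hw', map_one]⟩
    -- The element `e k` lies in `(p i).ker` and has length at most `L * lw.length`, a radius at
    -- which `p i` is injective at the identity.
    have hek : e k = 1 := Subtype.ext (hi3 _ (he lw k rfl) (e k).2)
    have hk : k = 1 := by rwa [map_eq_one_iff e e.injective] at hek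
    have : FreeGroup.mk lw ∈ σ.ker := congrArg Subtype.val hk
    rwa [hσker] at this
  filter_upwards [hc, hinjp (L * ρ' + (L + 1) ^ 2), hinjq ρ'] with i ⟨c⟩ hi1 hi2
  obtain ⟨e, -⟩ := exists_ker_mulEquiv hπ hRker.symm hR (p i) hπ' hker' hR' (q i) c hi1 hi2
  exact ⟨e.symm⟩

end KernelFamily

/-! ### Coarse inverses -/

section CoarseInverse

/-- `φ` and `ψ` are bornologous and mutually inverse up to an error of at most `C`. -/
structure IsCoarseInversePair {X Y : Type*} [PseudoMetricSpace X] [PseudoMetricSpace Y]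
    (φ : X → Y) (ψ : Y → X) (C : ℝ) : Prop where
  bornologous : ∀ r : ℝ, ∃ r' : ℝ, ∀ a b, dist a b ≤ r → dist (φ a) (φ b) ≤ r'
  bornologous_inv : ∀ r : ℝ, ∃ r' : ℝ, ∀ a b, dist a b ≤ r → dist (ψ a) (ψ b) ≤ r'
  left_inv : ∀ a, dist (ψ (φ a)) a ≤ C
  right_inv : ∀ b, dist (φ (ψ b)) b ≤ C

namespace IsCoarseInversePair

variable {X Y : Type*} [PseudoMetricSpace X] [PseudoMetricSpace Y] {φ : X → Y} {ψ : Y → X} {C : ℝ}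

theorem symm (h : IsCoarseInversePair φ ψ C) : IsCoarseInversePair ψ φ C :=
  ⟨h.bornologous_inv, h.bornologous, h.right_inv, h.left_inv⟩

theorem proper (h : IsCoarseInversePair φ ψ C) (r : ℝ) :
    ∃ r' : ℝ, ∀ a b, dist (φ a) (φ b) ≤ r → dist a b ≤ r' := by
  obtain ⟨r', hr'⟩ := h.bornologous_inv r
  refine ⟨C + r' + C, fun a b hab => ?_⟩
  have h2 := h.left_inv a
  rw [dist_comm] at h2
  have h3 := h.left_inv b
  have h4 := hr' _ _ hab
  have h5 := dist_triangle4 a (ψ (φ a)) (ψ (φ b)) b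
  linarith

end IsCoarseInversePair

theorem IsCoarseEquivalence.exists_isCoarseInversePair {X Y : Type*} [PseudoMetricSpace X]
    [PseudoMetricSpace Y] (hX : ∀ a b : X, ∃ n : ℕ, dist a b = n) {φ : X → Y}
    (hφ : IsCoarseEquivalence φ) : ∃ ψ C, IsCoarseInversePair φ ψ C := by
  obtain ⟨⟨ρ₁, ρ₂, h₁, -, hρ⟩, C, -, hC⟩ := hφ
  choose ψ hψ using hC
  have proper : ∀ r : ℝ, ∃ r' : ℝ, ∀ a b, dist (φ a) (φ b) ≤ r → dist a b ≤ r' := by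
    intro r
    obtain ⟨D, hD⟩ := Filter.eventually_atTop.1 (h₁.eventually_gt_atTop r.toNNReal)
    refine ⟨D, fun a b hab => ?_⟩
    by_contra! hlt
    have h1 := hD (nndist a b) (by rw [← NNReal.coe_le_coe, coe_nndist]; exact hlt.le)
    have h2 := h1.trans_le (hρ a b).1
    rw [← NNReal.coe_lt_coe, coe_nndist] at h2
    exact absurd ((Real.le_coe_toNNReal r).trans_lt h2) hab.not_gt
  obtain ⟨C', hC'⟩ := proper C
  refine ⟨ψ, max C C', fun r => ?_, fun r => ?_, fun a => ?_, fun b => ?_⟩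
  -- The function `ρ₂` need not be monotone or locally bounded; since distances in `X` are natural
  -- numbers, only finitely many of its values matter.
  · refine ⟨((∑ n ∈ Finset.range (⌊r⌋₊ + 1), ρ₂ n : ℝ≥0) : ℝ), fun a b hab => ?_⟩
    obtain ⟨n, hn⟩ := hX a b
    have hnn : nndist a b = n := by
      rw [← NNReal.coe_inj, coe_nndist, hn, NNReal.coe_natCast]
    have h1 := (hρ a b).2
    rw [hnn] at h1
    rw [← coe_nndist, NNReal.coe_le_coe]
    refine h1.trans (Finset.single_le_sum (f := fun n : ℕ => ρ₂ n) (fun _ _ => zero_le) ?_)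
    rw [Finset.mem_range, Nat.lt_succ_iff]
    exact Nat.le_floor (hn ▸ hab)
  · obtain ⟨r', hr'⟩ := proper (C + r + C)
    refine ⟨r', fun a b hab => hr' _ _ ?_⟩
    have h5 := dist_triangle4 (φ (ψ a)) a b (φ (ψ b))
    have h6 := hψ b
    rw [dist_comm] at h6
    linarith [hψ a]
  · exact (hC' _ _ (hψ (φ a))).trans (le_max_right _ _)
  · exact (hψ b).trans (le_max_left _ _)

end CoarseInverse

/-! ### Geometry of a single box space -/

namespace GroupFiltration

open Filter

section Single

variable {G : Type*} [Group G] (N : GroupFiltration G) {S : Set G} (hS : Subgroup.closure S = ⊤)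

/-- The point of the box space given by an element of the `i`-th quotient. -/
def toBox (i : ℕ) (x : G ⧸ N.sub i) : N.BoxSpace S hS := Sigma.mk i x

variable {N hS} in
/-- The index of the component containing a given point of the box space. -/
def boxIndex (a : N.BoxSpace S hS) : ℕ := Sigma.fst a

@[simp]
theorem boxIndex_toBox (i : ℕ) (x : G ⧸ N.sub i) : boxIndex (N.toBox hS i x) = i := rfl

variable {N hS} in
theorem exists_toBox_of_boxIndex {a : N.BoxSpace S hS} {i : ℕ} (h : boxIndex a = i) :
    ∃ x, a = N.toBox hS i x := by
  subst h
  exact ⟨Sigma.snd a, rfl⟩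

theorem dist_toBox_same (i : ℕ) (x y : G ⧸ N.sub i) :
    dist (N.toBox hS i x) (N.toBox hS i y) = ((N.quotientCayley S i).dist x y : ℝ) :=
  N.boxDist_same S i x y

theorem dist_toBox_ne {i j : ℕ} (h : i ≠ j) (x : G ⧸ N.sub i) (y : G ⧸ N.sub j) :
    dist (N.toBox hS i x) (N.toBox hS j y) =
      ((N.quotientCayley S i).diam : ℝ) + ((N.quotientCayley S j).diam : ℝ) :=
  N.boxDist_ne S h x y

theorem exists_dist_eq_natCast (a b : N.BoxSpace S hS) : ∃ n : ℕ, dist a b = n := by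
  obtain ⟨i, x⟩ := a
  obtain ⟨j, y⟩ := b
  by_cases h : i = j
  · subst h
    exact ⟨_, N.dist_toBox_same hS i x y⟩
  · exact ⟨_, (N.dist_toBox_ne hS h x y).trans (Nat.cast_add _ _).symm⟩

variable {N hS} in
theorem diam_le_dist_of_boxIndex_ne {a b : N.BoxSpace S hS} (h : boxIndex a ≠ boxIndex b) :
    ((N.quotientCayley S (boxIndex a)).diam : ℝ) ≤ dist a b := by
  obtain ⟨i, x⟩ := a
  obtain ⟨j, y⟩ := b
  exact (le_add_of_nonneg_right (Nat.cast_nonneg _)).trans_eq (N.dist_toBox_ne hS h x y).symm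

theorem dist_toBox_le_diam (i : ℕ) (x y : G ⧸ N.sub i) :
    dist (N.toBox hS i x) (N.toBox hS i y) ≤ ((N.quotientCayley S i).diam : ℝ) := by
  rw [dist_toBox_same]
  exact_mod_cast N.dist_le_diam hS i x y

open Pointwise in
/-- Points at bounded distance in the quotients differ by an element of a finite subset of `G`. -/
theorem exists_finite_of_dist_le (hSfin : S.Finite) (r : ℝ) : ∃ F : Set G, F.Finite ∧
    ∀ i (x y : G ⧸ N.sub i), dist (N.toBox hS i x) (N.toBox hS i y) ≤ r →
      ∃ g ∈ F, y = x * (g : G ⧸ N.sub i) := by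
  let A : Set G := {1} ∪ (S ∪ S⁻¹)
  have hA1 : (1 : G) ∈ A := Or.inl rfl
  have hAfin : A.Finite := (Set.finite_singleton _).union (hSfin.union hSfin.inv)
  have hpow : ∀ n : ℕ, (A ^ n).Finite := by
    intro n
    induction n with
    | zero => simp
    | succ n ih => rw [pow_succ]; exact ih.mul hAfin
  refine ⟨A ^ ⌊r⌋₊, hpow _, fun i x y hxy => ?_⟩
  have walk : ∀ (x y : G ⧸ N.sub i) (w : (N.quotientCayley S i).Walk x y),
      ∃ g ∈ A ^ w.length, y = x * (g : G ⧸ N.sub i) := by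
    intro x y w
    induction w with
    | nil => exact ⟨1, by simp, by simp⟩
    | @cons u v t h w ih =>
      obtain ⟨g, hg, rfl⟩ := ih
      rw [quotientCayley, SimpleGraph.mulCayley_adj'] at h
      obtain ⟨-, _, ⟨s, hs, rfl⟩, h | h⟩ := h
      · refine ⟨s * g, ?_, by rw [← h, mul_assoc, QuotientGroup.mk_mul]⟩
        rw [SimpleGraph.Walk.length_cons, pow_succ']
        exact Set.mul_mem_mul (Or.inr (Or.inl hs)) hg
      · refine ⟨s⁻¹ * g, ?_, by rw [h]; simp⟩
        rw [SimpleGraph.Walk.length_cons, pow_succ']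
        exact Set.mul_mem_mul (Or.inr (Or.inr (Set.inv_mem_inv.2 hs))) hg
  obtain ⟨w, hw⟩ := (N.quotientCayley_connected hS i).exists_walk_length_eq_dist x y
  obtain ⟨g, hg, e⟩ := walk x y w
  refine ⟨g, Set.pow_subset_pow_right hA1 ?_ hg, e⟩
  rw [hw]
  rw [dist_toBox_same] at hxy
  exact Nat.le_floor hxy

theorem exists_dist_mul_le (g : G) : ∃ r : ℝ, ∀ i (x : G ⧸ N.sub i),
    dist (N.toBox hS i x) (N.toBox hS i (x * (g : G ⧸ N.sub i))) ≤ r := by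
  have hg : g ∈ Subgroup.closure S := by rw [hS]; trivial
  induction hg using Subgroup.closure_induction with
  | mem s hs =>
    refine ⟨1, fun i x => ?_⟩
    by_cases h : x = x * (s : G ⧸ N.sub i)
    · rw [← h, dist_self]
      exact zero_le_one
    · have : (N.quotientCayley S i).Adj x (x * (s : G ⧸ N.sub i)) := by
        rw [quotientCayley, SimpleGraph.mulCayley_adj']
        exact ⟨h, _, ⟨s, hs, rfl⟩, Or.inl rfl⟩
      rw [dist_toBox_same, SimpleGraph.dist_eq_one_iff_adj.2 this, Nat.cast_one]
  | one => exact ⟨0, fun i x => by simp⟩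
  | mul a b _ _ ha hb =>
    obtain ⟨r, hr⟩ := ha
    obtain ⟨r', hr'⟩ := hb
    refine ⟨r + r', fun i x => (dist_triangle _ (N.toBox hS i (x * (a : G ⧸ N.sub i))) _).trans
      (add_le_add (hr i x) ?_)⟩
    rw [QuotientGroup.mk_mul, ← mul_assoc]
    exact hr' i _
  | inv a _ ha =>
    obtain ⟨r, hr⟩ := ha
    refine ⟨r, fun i x => ?_⟩
    have := hr i (x * ((a⁻¹ : G) : G ⧸ N.sub i))
    rwa [mul_assoc, ← QuotientGroup.mk_mul, inv_mul_cancel, QuotientGroup.mk_one, mul_one,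
      dist_comm] at this

theorem exists_mem_wordBall_of_dist_le {α : Type*} (hSfin : S.Finite)
    {π : FreeGroup α →* G} (hπ : Function.Surjective π) (r : ℝ) : ∃ n,
    ∀ i (x y : G ⧸ N.sub i), dist (N.toBox hS i x) (N.toBox hS i y) ≤ r →
      ∃ g ∈ wordBall ((QuotientGroup.mk' (N.sub i)).comp π) n, y = x * g := by
  obtain ⟨F, hF, h⟩ := N.exists_finite_of_dist_le hS hSfin r
  obtain ⟨n, hn⟩ := wordBall.exists_subset hπ hF
  refine ⟨n, fun i x y hxy => ?_⟩
  obtain ⟨g, hg, e⟩ := h i x y hxy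
  exact ⟨g, wordBall.map_mem (QuotientGroup.mk' (N.sub i)) (hn hg), e⟩

theorem exists_dist_mul_of_le {α : Type*} [Finite α]
    (π : FreeGroup α →* G) : ∃ r : ℝ, ∀ i (x : G ⧸ N.sub i) (a : α),
    dist (N.toBox hS i x) (N.toBox hS i (x * (π (FreeGroup.of a) : G ⧸ N.sub i))) ≤ r := by
  choose r hr using fun a => N.exists_dist_mul_le hS (π (FreeGroup.of a))
  obtain ⟨R, hR⟩ := (Set.finite_range r).bddAbove
  exact ⟨R, fun i x a => (hr a i x).trans (hR ⟨a, rfl⟩)⟩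

theorem eventually_notMem {g : G} (hg : g ≠ 1) : ∀ᶠ i in atTop, g ∉ N.sub i := by
  have : ¬ ∀ i, g ∈ N.sub i := by
    rw [← Subgroup.mem_iInf, N.iInf_eq_bot, Subgroup.mem_bot]
    exact hg
  push Not at this
  obtain ⟨i, hi⟩ := this
  exact eventually_atTop.2 ⟨i, fun j hj h => hi (N.antitone hj h)⟩

theorem eventually_injOn (F : Finset G) :
    ∀ᶠ i in atTop, Set.InjOn (fun g : G => (g : G ⧸ N.sub i)) F := by
  have : ∀ᶠ i in atTop, ∀ a ∈ F, ∀ b ∈ F, a ≠ b → a⁻¹ * b ∉ N.sub i := by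
    refine (eventually_all_finset F).2 fun a _ => (eventually_all_finset F).2 fun b _ => ?_
    by_cases hab : a = b
    · exact Eventually.of_forall fun i h => absurd hab h
    · filter_upwards [N.eventually_notMem (g := a⁻¹ * b) fun h => hab (inv_mul_eq_one.1 h)] with i hi
      exact fun _ => hi
  filter_upwards [this] with i hi a ha b hb hab
  by_contra hne
  exact hi a ha b hb hne (QuotientGroup.eq.1 hab)

theorem eventually_lt_card_quotient [Infinite G] (n : ℕ) :
    ∀ᶠ i in atTop, n < Nat.card (G ⧸ N.sub i) := by
  obtain ⟨F, hF⟩ := Infinite.exists_subset_card_eq G (n + 1)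
  filter_upwards [N.eventually_injOn F] with i hi
  have := Nat.card_le_card_of_injective (fun g : F => ((g : G) : G ⧸ N.sub i))
    fun a b hab => Subtype.ext (hi a.2 b.2 hab)
  rw [Nat.card_eq_fintype_card, Fintype.card_coe, hF] at this
  exact this

/-- If the diameter is at most `r`, a finite set independent of `i` maps onto the quotient, whose
order tends to infinity. -/
theorem eventually_lt_diam [Infinite G] (hS : Subgroup.closure S = ⊤) (hSfin : S.Finite) (r : ℝ) :
    ∀ᶠ i in atTop, r < ((N.quotientCayley S i).diam : ℝ) := by
  obtain ⟨F, hF, h⟩ := N.exists_finite_of_dist_le hS hSfin r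
  filter_upwards [N.eventually_lt_card_quotient F.ncard] with i hi
  by_contra! hle
  have huniv : (Set.univ : Set (G ⧸ N.sub i)) ⊆ (fun g : G => (g : G ⧸ N.sub i)) '' F := by
    intro y _
    obtain ⟨g, hg, e⟩ := h i 1 y ((N.dist_toBox_le_diam hS i 1 y).trans hle)
    exact ⟨g, hg, by rw [e, one_mul]⟩
  have h1 := Set.ncard_le_ncard huniv (hF.image _)
  rw [Set.ncard_univ] at h1
  exact absurd (h1.trans (Set.ncard_image_le hF)) hi.not_ge

theorem eventually_sub_eq_bot [Finite G] : ∀ᶠ i in atTop, N.sub i = ⊥ := by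
  have : ∀ᶠ i in atTop, ∀ g : G, g ≠ 1 → g ∉ N.sub i := by
    refine eventually_all.2 fun g => ?_
    by_cases hg : g = 1
    · exact Eventually.of_forall fun i h => absurd hg h
    · filter_upwards [N.eventually_notMem hg] with i hi _ using hi
  filter_upwards [this] with i hi
  rw [Subgroup.eq_bot_iff_forall]
  intro g hg
  by_contra h
  exact hi g h hg

theorem exists_dist_le_of_finite [Finite G] :
    ∃ r : ℝ, ∀ a b : N.BoxSpace S hS, dist a b ≤ r := by
  choose r hr using N.exists_dist_mul_le hS
  obtain ⟨R, hR⟩ := (Set.finite_range r).bddAbove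
  have hle : ∀ i (x y : G ⧸ N.sub i), dist (N.toBox hS i x) (N.toBox hS i y) ≤ R := by
    intro i x y
    obtain ⟨g, hg⟩ := QuotientGroup.mk_surjective (x⁻¹ * y)
    have := hr g i x
    rw [hg, mul_inv_cancel_left] at this
    exact this.trans (hR ⟨g, rfl⟩)
  have hd : ∀ i, ((N.quotientCayley S i).diam : ℝ) ≤ R := by
    intro i
    obtain ⟨x, y, hxy⟩ := (N.quotientCayley S i).exists_dist_eq_diam
    rw [← hxy, ← N.dist_toBox_same hS]
    exact hle i x y
  refine ⟨R + R, ?_⟩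
  rintro ⟨i, x⟩ ⟨j, y⟩
  by_cases h : i = j
  · subst h
    exact (hle i x y).trans (by linarith [dist_nonneg.trans (hle i x y)])
  · exact (N.dist_toBox_ne hS h x y).trans_le (add_le_add (hd i) (hd j))

theorem IsStrict.two_pow_mul_card_le {N : GroupFiltration G} [Infinite G] (hN : N.IsStrict)
    (i m : ℕ) : 2 ^ m * Nat.card (G ⧸ N.sub i) ≤ Nat.card (G ⧸ N.sub (i + m)) := by
  induction m with
  | zero => simp
  | succ m ih =>
    have hne : N.sub (i + m) ≠ ⊥ := by
      intro h
      have := (N.finiteIndex (i + m))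
      rw [h] at this
      have : Finite G := Finite.of_equiv _ (QuotientGroup.quotientBot (G := G)).toEquiv
      exact not_finite G
    have hlt := hN (i + m) hne
    have h1 := Subgroup.relIndex_mul_index hlt.le
    have h2 : (N.sub (i + m + 1)).relIndex (N.sub (i + m)) ≠ 1 := fun h =>
      hlt.not_ge (Subgroup.relIndex_eq_one.1 h)
    have h3 : (N.sub (i + m + 1)).relIndex (N.sub (i + m)) ≠ 0 := fun h => by
      rw [h, zero_mul] at h1
      exact (N.finiteIndex (i + m + 1)).index_ne_zero h1.symm
    calc 2 ^ (m + 1) * Nat.card (G ⧸ N.sub i)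
        = 2 * (2 ^ m * Nat.card (G ⧸ N.sub i)) := by ring
      _ ≤ (N.sub (i + m + 1)).relIndex (N.sub (i + m)) * Nat.card (G ⧸ N.sub (i + m)) :=
          Nat.mul_le_mul (by omega) ih
      _ = Nat.card (G ⧸ N.sub (i + (m + 1))) := h1

theorem card_quotient_mono : Monotone fun i => Nat.card (G ⧸ N.sub i) :=
  fun _ _ h => Subgroup.index_antitone (N.antitone h)

end Single

end GroupFiltration

/-! ### Coarse equivalences of box spaces, component by component -/

namespace IsCoarseInversePair

open Filter GroupFiltration

variable {G H : Type*} [Group G] [Group H] {N : GroupFiltration G} {M : GroupFiltration H}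
  {S : Set G} {hS : Subgroup.closure S = ⊤} {T : Set H} {hT : Subgroup.closure T = ⊤}
  {φ : N.BoxSpace S hS → M.BoxSpace T hT} {ψ : M.BoxSpace T hT → N.BoxSpace S hS} {C : ℝ}

theorem finite_of_finite (h : IsCoarseInversePair φ ψ C) (hTfin : T.Finite) [Finite G] :
    Finite H := by
  by_contra hH
  rw [not_finite_iff_infinite] at hH
  obtain ⟨r, hr⟩ := N.exists_dist_le_of_finite hS
  obtain ⟨r', hr'⟩ := h.symm.proper r
  obtain ⟨i, hi⟩ := (M.eventually_lt_diam hT hTfin r').exists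
  have := (diam_le_dist_of_boxIndex_ne (a := M.toBox hT i 1) (b := M.toBox hT (i + 1) 1)
    (by simp)).trans (hr' _ _ (hr _ _))
  exact absurd this hi.not_ge

/-- Points sent to component `j` are within a bounded distance of one another, but the `i`-th
component recedes from any fixed point. -/
theorem eventually_boxIndex_ne (h : IsCoarseInversePair φ ψ C) (hSfin : S.Finite) [Infinite G]
    (j : ℕ) : ∀ᶠ i in atTop, ∀ x, boxIndex (φ (N.toBox hS i x)) ≠ j := by
  by_cases hex : ∃ a, boxIndex (φ a) = j
  · obtain ⟨a, ha⟩ := hex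
    obtain ⟨D, hD⟩ := h.proper (M.quotientCayley T j).diam
    filter_upwards [N.eventually_lt_diam hS hSfin D, eventually_gt_atTop (boxIndex a)]
      with i hi hia x hx
    obtain ⟨y, hy⟩ := exists_toBox_of_boxIndex hx
    obtain ⟨z, hz⟩ := exists_toBox_of_boxIndex ha
    have h1 := hD (N.toBox hS i x) a (by rw [hy, hz]; exact M.dist_toBox_le_diam hT j y z)
    have h2 := (diam_le_dist_of_boxIndex_ne (a := N.toBox hS i x) (b := a)
      (by simpa using hia.ne')).trans h1
    exact absurd h2 hi.not_ge
  · push Not at hex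
    exact Eventually.of_forall fun i x => hex _

theorem eventually_le_boxIndex (h : IsCoarseInversePair φ ψ C) (hSfin : S.Finite) [Infinite G]
    (J : ℕ) : ∀ᶠ i in atTop, ∀ x, J ≤ boxIndex (φ (N.toBox hS i x)) := by
  have : ∀ᶠ i in atTop, ∀ j ∈ Finset.range J, ∀ x, boxIndex (φ (N.toBox hS i x)) ≠ j :=
    (eventually_all_finset _).2 fun j _ => h.eventually_boxIndex_ne hSfin j
  filter_upwards [this] with i hi x
  by_contra! hlt
  exact hi _ (Finset.mem_range.2 hlt) x rfl

/-- The index of the component to which the base point of the `i`-th component is mapped. -/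
def indexMap (φ : N.BoxSpace S hS → M.BoxSpace T hT) (i : ℕ) : ℕ :=
  boxIndex (φ (N.toBox hS i 1))

theorem tendsto_indexMap (h : IsCoarseInversePair φ ψ C) (hSfin : S.Finite) [Infinite G] :
    Tendsto (indexMap φ) atTop atTop :=
  tendsto_atTop.2 fun J => (h.eventually_le_boxIndex hSfin J).mono fun _ hi => hi 1

/-- Eventually, components are mapped into components. -/
theorem eventually_boxIndex_eq (h : IsCoarseInversePair φ ψ C) (hSfin : S.Finite)
    (hTfin : T.Finite) [Infinite G] [Infinite H] :
    ∀ᶠ i in atTop, ∀ x, boxIndex (φ (N.toBox hS i x)) = indexMap φ i := by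
  obtain ⟨r, hr⟩ := h.bornologous 1
  -- Beyond `J`, distinct components are more than `r` apart, so adjacent points cannot be sent to
  -- different ones.
  obtain ⟨J, hJ⟩ := eventually_atTop.1 (M.eventually_lt_diam hT hTfin r)
  filter_upwards [h.eventually_le_boxIndex hSfin J] with i hi
  have adj : ∀ x y, (N.quotientCayley S i).Adj x y →
      boxIndex (φ (N.toBox hS i x)) = boxIndex (φ (N.toBox hS i y)) := by
    intro x y hxy
    by_contra hne
    have h1 := hr (N.toBox hS i x) (N.toBox hS i y)
      (by rw [dist_toBox_same, SimpleGraph.dist_eq_one_iff_adj.2 hxy, Nat.cast_one])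
    exact absurd ((diam_le_dist_of_boxIndex_ne hne).trans h1) (hJ _ (hi x)).not_ge
  have walk : ∀ x y, (N.quotientCayley S i).Walk x y →
      boxIndex (φ (N.toBox hS i x)) = boxIndex (φ (N.toBox hS i y)) := by
    intro x y w
    induction w with
    | nil => rfl
    | cons hadj _ ih => exact (adj _ _ hadj).trans ih
  intro x
  obtain ⟨w⟩ := (N.quotientCayley_connected hS i).preconnected x 1
  exact walk x 1 w

theorem eventually_indexMap_indexMap (h : IsCoarseInversePair φ ψ C) (hSfin : S.Finite)
    (hTfin : T.Finite) [Infinite G] [Infinite H] :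
    ∀ᶠ i in atTop, indexMap ψ (indexMap φ i) = i := by
  filter_upwards [N.eventually_lt_diam hS hSfin C, (h.tendsto_indexMap hSfin).eventually
    (h.symm.eventually_boxIndex_eq hTfin hSfin)] with i hi hi'
  obtain ⟨y, hy⟩ := exists_toBox_of_boxIndex (rfl : boxIndex (φ (N.toBox hS i 1)) = _)
  have h1 := hi' y
  change boxIndex (ψ (M.toBox hT (boxIndex (φ (N.toBox hS i 1))) y)) = _ at h1
  rw [← hy] at h1
  rw [← h1]
  by_contra hne
  have h2 := h.left_inv (N.toBox hS i 1)
  rw [dist_comm] at h2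
  exact absurd ((diam_le_dist_of_boxIndex_ne (a := N.toBox hS i 1) (Ne.symm hne)).trans h2)
    hi.not_ge

/-- The coarse equivalences induced between components are uniform. -/
theorem exists_eventually_markedCoarseEquiv (h : IsCoarseInversePair φ ψ C) (hSfin : S.Finite)
    (hTfin : T.Finite) [Infinite G] [Infinite H] {α β : Type*} [Finite α] [Finite β]
    {π : FreeGroup α →* G} (hπ : Function.Surjective π)
    {π' : FreeGroup β →* H} (hπ' : Function.Surjective π') :
    ∃ L, ∀ᶠ i in atTop, Nonempty (MarkedCoarseEquiv ((QuotientGroup.mk' (N.sub i)).comp π)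
      ((QuotientGroup.mk' (M.sub (indexMap φ i))).comp π') L) := by
  classical
  obtain ⟨r₁, hr₁⟩ := exists_dist_mul_of_le N hS π
  obtain ⟨r₂, hr₂⟩ := exists_dist_mul_of_le M hT π'
  obtain ⟨s₁, hs₁⟩ := h.bornologous r₁
  obtain ⟨s₂, hs₂⟩ := h.bornologous_inv r₂
  obtain ⟨n₁, hn₁⟩ := exists_mem_wordBall_of_dist_le M hT hTfin hπ' s₁
  obtain ⟨n₂, hn₂⟩ := exists_mem_wordBall_of_dist_le N hS hSfin hπ (C + s₂ + C)
  obtain ⟨n₃, hn₃⟩ := exists_mem_wordBall_of_dist_le N hS hSfin hπ (C + C)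
  obtain ⟨n₄, hn₄⟩ := exists_mem_wordBall_of_dist_le M hT hTfin hπ' C
  refine ⟨n₁ + n₂ + n₃ + n₄, ?_⟩
  filter_upwards [h.eventually_boxIndex_eq hSfin hTfin, (h.tendsto_indexMap hSfin).eventually
    (h.symm.eventually_boxIndex_eq hTfin hSfin), h.eventually_indexMap_indexMap hSfin hTfin]
    with i hi hi' hii
  simp only [hii] at hi'
  choose f hf using fun x => exists_toBox_of_boxIndex (hi x)
  choose g hg using fun y => exists_toBox_of_boxIndex (hi' y)
  have hgf : ∀ x, dist (N.toBox hS i (g (f x))) (N.toBox hS i x) ≤ C := fun x => by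
    rw [← hg, ← hf]; exact h.left_inv _
  have hfg : ∀ y, dist (M.toBox hT _ (f (g y))) (M.toBox hT _ y) ≤ C := fun y => by
    rw [← hf, ← hg]; exact h.right_inv _
  have hC0 : 0 ≤ C := dist_nonneg.trans (hgf 1)
  -- Translating by `f 1` normalises `f`, but then `g (f 1)` is only within `C` of `1`; changing the
  -- value at `y = 1` costs one more `C`.
  let g' : H ⧸ M.sub (indexMap φ i) → G ⧸ N.sub i := fun y => if y = 1 then 1 else g (f 1 * y)
  have hg' : ∀ y, dist (N.toBox hS i (g' y)) (N.toBox hS i (g (f 1 * y))) ≤ C := by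
    intro y
    by_cases hy : y = 1
    · simp only [g', hy, if_true, mul_one]
      rw [dist_comm]
      exact hgf 1
    · simp only [g', hy, if_false, dist_self]
      exact hC0
  refine ⟨⟨fun x => (f 1)⁻¹ * f x, g', by simp, by simp [g'], fun x a => ?_, fun y b => ?_,
    fun x => ?_, fun y => ?_⟩⟩
  · obtain ⟨y, hy, e⟩ := hn₁ _ (f x) (f (x * (π (FreeGroup.of a) : G ⧸ N.sub i)))
      (by rw [← hf, ← hf]; exact hs₁ _ _ (hr₁ i x a))
    refine ⟨y, wordBall.mono (by omega) hy, ?_⟩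
    rw [mul_assoc, ← e]
    rfl
  · set y' := y * (π' (FreeGroup.of b) : H ⧸ M.sub (indexMap φ i)) with hy'
    obtain ⟨x, hx, e⟩ := hn₂ i (g' y) (g' y') (by
      have h1 := hs₂ _ _ (hr₂ _ (f 1 * y) b)
      rw [hg, hg, mul_assoc, ← hy'] at h1
      have h2 := hg' y'
      rw [dist_comm] at h2
      exact (dist_triangle4 _ _ _ _).trans (add_le_add (add_le_add (hg' y) h1) h2))
    exact ⟨x, wordBall.mono (by omega) hx, e⟩
  · obtain ⟨z, hz, e⟩ := hn₃ i x (g' ((f 1)⁻¹ * f x)) (by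
      have h1 := hg' ((f 1)⁻¹ * f x)
      rw [mul_inv_cancel_left] at h1
      rw [dist_comm]
      exact (dist_triangle _ _ _).trans (add_le_add h1 (hgf x)))
    exact ⟨z, wordBall.mono (by omega) hz, e⟩
  · by_cases hy : y = 1
    · exact ⟨1, wordBall.one_mem, by simp [g', hy]⟩
    · obtain ⟨z, hz, e⟩ := hn₄ _ (f 1 * y) (f (g (f 1 * y)))
        (by rw [dist_comm]; exact hfg _)
      refine ⟨z, wordBall.mono (by omega) hz, ?_⟩
      simp only [g', hy, if_false, e]
      group

end IsCoarseInversePair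

/-! ### Bounded displacement by counting -/

section Displacement

/-- Every value below `f n` is either missed by `f` or attained at one of the `n + a + 1` indices up
to `n + a`. -/
theorem exists_forall_apply_le {f : PartialEquiv ℕ ℕ} (hf : f.targetᶜ.Finite) {a : ℕ}
    (h : ∀ i ∈ f.source, ∀ j ∈ f.source, i + a < j → f i < f j) :
    ∃ A, ∀ n ∈ f.source, f n ≤ n + A := by
  refine ⟨hf.toFinset.card + (a + 1), fun n hn => ?_⟩
  have hsub : Finset.range (f n) ⊆ hf.toFinset ∪ (Finset.range (n + a + 1)).image f := by
    intro j hj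
    rw [Finset.mem_union, Set.Finite.mem_toFinset, Finset.mem_image]
    by_cases hjt : j ∈ f.target
    · refine Or.inr ⟨f.symm j, ?_, f.right_inv hjt⟩
      by_contra hlt
      rw [Finset.mem_range] at hj hlt
      have := h n hn _ (f.map_target hjt) (by omega)
      rw [f.right_inv hjt] at this
      omega
    · exact Or.inl hjt
  have h1 := (Finset.card_le_card hsub).trans (Finset.card_union_le _ _)
  have h2 := (Finset.card_image_le (s := Finset.range (n + a + 1)) (f := f))
  rw [Finset.card_range] at h1 h2
  omega

/-- If `f (i + m) ≤ f i`, then `2 ^ m * I i ≤ I (i + m) ≤ k * k * I i`, so `m < 2 ^ m ≤ k * k`. -/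
theorem exists_lt_of_card_le {I J : ℕ → ℕ} {s : Set ℕ} {f : ℕ → ℕ}
    (hI : ∀ i m, 2 ^ m * I i ≤ I (i + m)) (hI0 : ∀ i, 0 < I i) (hJ : Monotone J) {k : ℕ}
    (h₁ : ∀ i ∈ s, I i ≤ J (f i) * k) (h₂ : ∀ i ∈ s, J (f i) ≤ I i * k) :
    ∀ i ∈ s, ∀ j ∈ s, i + k * k < j → f i < f j := by
  intro i hi j hj hij
  by_contra! hle
  obtain ⟨m, rfl⟩ := Nat.exists_eq_add_of_le (show i ≤ j by omega)
  have h3 : I (i + m) ≤ k * k * I i := by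
    calc I (i + m) ≤ J (f (i + m)) * k := h₁ _ hj
      _ ≤ (I i * k) * k := Nat.mul_le_mul_right _ ((hJ hle).trans (h₂ i hi))
      _ = k * k * I i := by ring
  have h4 : 2 ^ m ≤ k * k := Nat.le_of_mul_le_mul_right ((hI i m).trans h3) (hI0 i)
  have h5 : m < 2 ^ m := Nat.lt_two_pow_self
  omega

end Displacement

/-! ### The almost permutation and the main theorem -/

section Main

open Filter GroupFiltration IsCoarseInversePair

/-- The partial bijection given by two maps `f`, `g` between `ℕ` that are mutually inverse on the
points satisfying `P`. -/
def PartialEquiv.ofEventuallyInverse {α β : Type*} (f : α → β) (g : β → α) (P : α → Prop) :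
    PartialEquiv α β where
  toFun := f
  invFun := g
  source := {i | g (f i) = i ∧ P i}
  target := {j | f (g j) = j ∧ P (g j)}
  map_source' := fun i hi => ⟨by rw [hi.1], by rw [hi.1]; exact hi.2⟩
  map_target' := fun j hj => ⟨by rw [hj.1], hj.2⟩
  left_inv' := fun _ hi => hi.1
  right_inv' := fun _ hj => hj.1

theorem finite_compl_of_eventually {s : Set ℕ} (h : ∀ᶠ i in atTop, i ∈ s) : sᶜ.Finite := by
  rwa [← Nat.cofinite_eq_atTop] at h

theorem exists_almostPermutation_of_finite {G H : Type*} [Group G] [Group H] [Finite G] [Finite H]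
    (N : GroupFiltration G) (M : GroupFiltration H) :
    ∃ f : PartialEquiv ℕ ℕ, IsAlmostPermutation f ∧
      (∀ i ∈ f.source, Nonempty (N.sub i ≃* M.sub (f i))) ∧ HasBoundedDisplacement f := by
  let s : Set ℕ := {i | N.sub i = ⊥ ∧ M.sub i = ⊥}
  have hs : sᶜ.Finite := finite_compl_of_eventually
    (N.eventually_sub_eq_bot.and M.eventually_sub_eq_bot)
  refine ⟨PartialEquiv.ofSet s, ⟨hs, hs⟩, fun i hi => ?_, 0, 0, fun n _ _ => ?_⟩
  · obtain ⟨h1, h2⟩ : N.sub i = ⊥ ∧ M.sub i = ⊥ := hi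
    change Nonempty (N.sub i ≃* M.sub i)
    rw [h1, h2]
    exact ⟨MulEquiv.ofUnique⟩
  · simp

theorem theorem1p3 {G H : Type*} [Group G] [Group H]
    [Group.IsFinitelyPresented G] [Group.FG H]
    (N : GroupFiltration G) (M : GroupFiltration H)
    (S : Set G) (hSfin : S.Finite) (hS : Subgroup.closure S = ⊤)
    (T : Set H) (hTfin : T.Finite) (hT : Subgroup.closure T = ⊤)
    (hCE : CoarselyEquivalent (N.BoxSpace S hS) (M.BoxSpace T hT)) :
    ∃ f : PartialEquiv ℕ ℕ, IsAlmostPermutation f ∧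
      (∀ i ∈ f.source, Nonempty (N.sub i ≃* M.sub (f i))) ∧
      (N.IsStrict → M.IsStrict → HasBoundedDisplacement f) := by
  obtain ⟨φ, hφ⟩ := hCE
  obtain ⟨ψ, C, h⟩ := hφ.exists_isCoarseInversePair (N.exists_dist_eq_natCast hS)
  rcases finite_or_infinite G with hG | hG
  · have := h.finite_of_finite hTfin
    obtain ⟨f, h1, h2, h3⟩ := exists_almostPermutation_of_finite N M
    exact ⟨f, h1, h2, fun _ _ => h3⟩
  have hH : Infinite H := by
    by_contra hH
    rw [not_infinite_iff_finite] at hH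
    exact (h.symm.finite_of_finite hSfin).not_infinite hG
  obtain ⟨n, π, hπ, hker⟩ := Group.IsFinitelyPresented.out (G := G)
  have := hTfin.to_subtype
  let π' : FreeGroup T →* H := FreeGroup.lift Subtype.val
  have hπ' : Function.Surjective π' := by
    rw [← MonoidHom.range_eq_top, FreeGroup.range_lift_eq_closure, Subtype.range_coe, hT]
  obtain ⟨L, hL⟩ := h.exists_eventually_markedCoarseEquiv hSfin hTfin hπ hπ'
  have hiso := eventually_nonempty_ker_mulEquiv (l := atTop) hπ hker hπ'
    (p := fun i => QuotientGroup.mk' (N.sub i))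
    (q := fun i => QuotientGroup.mk' (M.sub (indexMap φ i)))
    (fun g hg => by
      filter_upwards [N.eventually_notMem hg] with i hi
      rwa [QuotientGroup.mk'_apply, Ne, QuotientGroup.eq_one_iff])
    (fun g hg => by
      filter_upwards [(h.tendsto_indexMap hSfin).eventually (M.eventually_notMem hg)] with i hi
      rwa [QuotientGroup.mk'_apply, Ne, QuotientGroup.eq_one_iff]) hL
  obtain ⟨k, hk⟩ : ∃ k, ∀ᶠ i in atTop,
      Nat.card (G ⧸ N.sub i) ≤ Nat.card (H ⧸ M.sub (indexMap φ i)) * k ∧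
      Nat.card (H ⧸ M.sub (indexMap φ i)) ≤ Nat.card (G ⧸ N.sub i) * k := by
    refine ⟨(wordBall π L).ncard + (wordBall π' L).ncard, hL.mono fun i ⟨c⟩ => ?_⟩
    have h1 := c.card_le
    have h2 := c.symm.card_le
    have h3 : (wordBall ((QuotientGroup.mk' (N.sub i)).comp π) L).ncard ≤ (wordBall π L).ncard :=
      wordBall.ncard_comp_le _ _ _
    have h4 : (wordBall ((QuotientGroup.mk' (M.sub (indexMap φ i))).comp π') L).ncard ≤
      (wordBall π' L).ncard := wordBall.ncard_comp_le _ _ _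
    exact ⟨h1.trans (Nat.mul_le_mul_left _ (by omega)), h2.trans (Nat.mul_le_mul_left _ (by omega))⟩
  -- The cardinality bounds are built into the domain, so the displacement estimate holds on all of
  -- it, with `n₀ = 0`.
  let P : ℕ → Prop := fun i => Nonempty (N.sub i ≃* M.sub (indexMap φ i)) ∧
      Nat.card (G ⧸ N.sub i) ≤ Nat.card (H ⧸ M.sub (indexMap φ i)) * k ∧
      Nat.card (H ⧸ M.sub (indexMap φ i)) ≤ Nat.card (G ⧸ N.sub i) * k
  have hP : ∀ᶠ i in atTop, P i := by
    filter_upwards [hiso, hk] with i ⟨e⟩ hi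
    exact ⟨⟨(MulEquiv.subgroupCongr (QuotientGroup.ker_mk' _).symm).trans
      (e.trans (MulEquiv.subgroupCongr (QuotientGroup.ker_mk' _)))⟩, hi⟩
  let f := PartialEquiv.ofEventuallyInverse (indexMap φ) (indexMap ψ) P
  have hs : f.sourceᶜ.Finite :=
    finite_compl_of_eventually ((h.eventually_indexMap_indexMap hSfin hTfin).and hP)
  have ht : f.targetᶜ.Finite :=
    finite_compl_of_eventually ((h.symm.eventually_indexMap_indexMap hTfin hSfin).and
      ((h.symm.tendsto_indexMap hTfin).eventually hP))
  refine ⟨f, ⟨hs, ht⟩, fun i hi => hi.2.1, fun hN hM => ?_⟩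
  obtain ⟨A, hA⟩ := exists_forall_apply_le ht (exists_lt_of_card_le (k := k)
    hN.two_pow_mul_card_le (fun i => Nat.card_pos) M.card_quotient_mono (f := f) (s := f.source)
    (fun i hi => hi.2.2.1) (fun i hi => hi.2.2.2))
  -- The lower bound for `f n` is the upper bound for `f.symm` at `f n`; here strictness of `M` is
  -- used.
  obtain ⟨B, hB⟩ := exists_forall_apply_le (f := f.symm) hs (exists_lt_of_card_le (k := k)
    hM.two_pow_mul_card_le (fun i => Nat.card_pos) N.card_quotient_mono
    (f := f.symm) (s := f.target) (fun j (hj : j ∈ f.target) => by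
      have := (f.map_target hj).2.2.2
      rwa [show indexMap φ (f.symm j) = j from f.right_inv hj] at this)
    (fun j hj => by
      have := (f.map_target hj).2.2.1
      rwa [show indexMap φ (f.symm j) = j from f.right_inv hj] at this))
  refine ⟨A + B, 0, fun n hn _ => ?_⟩
  have h1 := hA n hn
  have h2 := hB (f n) (f.map_source hn)
  rw [f.left_inv hn] at h2
  rw [abs_le]
  omega

end Main
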